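/- There exist absolute constants $C,D,C',D'>0$ such that the following holds for all $1\le p\le\infty$, all $0<\eta<1$ and all natural numbers $m,N,s$ with $1\le s\le N$ and $$m\ \ge\ C\,s\log(eN/s)+D\log(2\eta^{-1}).$$ Let $\Phi$ be an $m\times N$ standard Gaussian matrix, i.e. a random real matrix with independent $N(0,1)$ entries. Then with probability exceeding $1-\eta$ the following is true simultaneously for every $x^{\natural}\in\mathbb{R}^N$, every $\varepsilon\ge 0$ and every $e\in\mathbb{R}^m$ with $\|e\|_{\ell_p}\le\varepsilon$: setting $y=\Phi x^{\natural}+e$, any solution $x^{\star}$ of $$\min_{x\in\mathbb{R}^N}\ \|x\|_{\ell_1}\quad\text{subject to}\quad \|\Phi x-y\|_{\ell_p}\le\varepsilon$$ satisfies $$\|x^{\star}-x^{\natural}\|_{\ell_2}\ \le\ \frac{C'}{\sqrt{s}}\,\sigma_s(x^{\natural})_1+\frac{D'}{m^{1/p}}\,\varepsilon,$$ where $\sigma_s(x^{\natural})_1=\inf\{\|x^{\natural}-z\|_{\ell_1}: z\in\mathbb{R}^N,\ \|z\|_{\ell_0}\le s\}$, $\|z\|_{\ell_0}$ is the number of nonzero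 entries of $z$, and $m^{1/p}=1$ for $p=\infty$. -/

import Mathlib

open MeasureTheory ProbabilityTheory
open scoped ENNReal Matrix

/-- The `ℓ_p` norm on `ℝⁿ` for an extended exponent `p` (for `p = ∞` it is the maximum norm). -/
noncomputable def ellNorm {n : ℕ} (p : ℝ≥0∞) (v : Fin n → ℝ) : ℝ :=
  ‖WithLp.toLp p v‖

/-- The `ℓ_1` error of best `s`-term approximation, `σ_s(x)_1 = inf {‖x - z‖_1 : ‖z‖_0 ≤ s}`;
`hammingNorm z` is the number of nonzero entries of `z`. -/
noncomputable def bestApproxError {N : ℕ} (s : ℕ) (x : Fin N → ℝ) : ℝ :=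
  sInf ((fun z : Fin N → ℝ => ellNorm 1 (x - z)) '' {z | hammingNorm z ≤ s})

/-- The vectors `x` with `‖Φ x - y‖_p ≤ ε`. -/
def feasibleSet {m N : ℕ} (p : ℝ≥0∞) (Φ : Matrix (Fin m) (Fin N) ℝ) (y : Fin m → ℝ) (ε : ℝ) :
    Set (Fin N → ℝ) :=
  {x | ellNorm p (Φ *ᵥ x - y) ≤ ε}

/-- `x` is a solution of: minimize `‖x‖_1` subject to `‖Φ x - y‖_p ≤ ε`. -/
def IsL1Minimizer {m N : ℕ} (p : ℝ≥0∞) (Φ : Matrix (Fin m) (Fin N) ℝ) (y : Fin m → ℝ) (ε : ℝ)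
    (x : Fin N → ℝ) : Prop :=
  x ∈ feasibleSet p Φ y ε ∧ ∀ z ∈ feasibleSet p Φ y ε, ellNorm 1 x ≤ ellNorm 1 z

/-- A random `m × N` matrix is standard Gaussian if its entries are independent `N(0,1)` random
variables. -/
structure IsStandardGaussianMatrix {Ω : Type*} [MeasurableSpace Ω] (P : Measure Ω) {m N : ℕ}
    (Φ : Ω → Matrix (Fin m) (Fin N) ℝ) : Prop where
  hasLaw : ∀ i j, HasLaw (fun ω => Φ ω i j) (gaussianReal 0 1) P
  indep : iIndepFun (fun (ij : Fin m × Fin N) ω => Φ ω ij.1 ij.2) P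

/-!
The error `h = xStar - x` satisfies two deterministic constraints. Minimality of `xStar` gives
`‖h‖₁ ≤ 2 √s ‖h‖₂ + 2 σ_s(x)₁` (`ellNorm_one_le_of_ellNorm_one_add_le`), and feasibility of `x` and
`xStar` gives `‖Φ h‖_p ≤ 2 ε`, hence `‖Φ h‖₁ ≤ m ^ (1 - 1/p) * 2 ε` by Hölder. If
`√s ‖h‖₂ ≤ 2 σ_s(x)₁` there is nothing left to show. Otherwise `h` lies in the cone
`‖h‖₁ ≤ 3 √s ‖h‖₂`, and it suffices that `‖Φ h‖₁ ≥ (m / 200) ‖h‖₂` on this cone: only a lower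
`ℓ₁` bound is needed, which is why a single event serves all `p` at once.

The lower bound on the cone (`lower_bound_on_cone`) combines two random events.

* An upper bound for all vectors: `‖Φ v‖₁ ≤ 4 m (‖v‖₂ + ‖v‖₁ / (9600 √s))`. Since `‖Φ v‖₁` is the
  largest of the numbers `⟨Φᵀ σ, v⟩` over sign vectors `σ`, it is enough to split each Gaussian
  vector `Φᵀ σ / √m` into a part with entries at most `t` and a remainder of small `ℓ₂` norm. The
  squared remainder `∑ (|g_j| - t)₊²` is controlled by its exponential moment, and there are only
  `2 ^ m` sign vectors.
* A lower bound `‖Φ n‖₁ ≥ (m / 100) ‖n‖₂` for the nonzero integer vectors with `‖n‖₁ ≤ 92160000 s`.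
  For one vector it fails with probability at most `exp (-3 m)`, because `E exp (-100 |g|) ≤ 1 / 100`.
  A generating function bounds the number of such `n` by `exp (O (s log (e N / s)))`
  (`card_latticeBall_le_exp`).

A vector `h` of the cone is rounded coordinatewise toward zero to a multiple `β n` of such an integer
vector. The rounding error `w` satisfies `|w_j| ≤ min β |h_j|`, so `‖w‖₂² ≤ β ‖h‖₁` is small while
`‖w‖₁ ≤ ‖h‖₁`, and the upper bound shows that `‖Φ w‖₁` is negligible. Rounding toward zero replaces
both the `ε`-net of the set of sparse vectors and the block decomposition by decreasing rearrangement.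
-/

/-! ### Exponential moments of Gaussian variables -/

/-- Rows of a Gaussian array paired with a fixed unit vector are again i.i.d. standard Gaussian:
the resulting family is jointly Gaussian and its covariance matrix is the identity. -/
lemma iid_gaussian_sum_mul_of_sum_sq_eq_one {Ω α β : Type*} [MeasurableSpace Ω] {P : Measure Ω}
    [Fintype α] [Fintype β] {X : α → β → Ω → ℝ}
    (hX : ∀ i j, HasLaw (X i j) (gaussianReal 0 1) P)
    (hind : iIndepFun (fun (q : α × β) => X q.1 q.2) P) {a : β → ℝ} (ha : ∑ j, a j ^ 2 = 1) :
    (∀ i, HasLaw (fun ω => ∑ j, a j * X i j ω) (gaussianReal 0 1) P) ∧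
      iIndepFun (fun i ω => ∑ j, a j * X i j ω) P := by
  classical
  have hP : IsProbabilityMeasure P := hind.isProbabilityMeasure
  have hG : ∀ i j, HasGaussianLaw (X i j) P := fun i j => (hX i j).hasGaussianLaw
  have hjoint : HasGaussianLaw (fun ω (q : α × β) => X q.1 q.2 ω) P :=
    hind.hasGaussianLaw fun q => hG q.1 q.2
  let L : (α × β → ℝ) →L[ℝ] (α → ℝ) :=
    ContinuousLinearMap.pi fun i => ∑ j, a j • ContinuousLinearMap.proj (i, j)
  have hY : HasGaussianLaw (fun ω i => ∑ j, a j * X i j ω) P := by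
    have h := hjoint.map_fun L
    have hL : (fun ω i => ∑ j, a j * X i j ω) = fun ω => L fun q : α × β => X q.1 q.2 ω := by
      ext ω i
      simp [L]
    rw [hL]; exact h
  have hL2 : ∀ i j, MemLp (X i j) 2 P := fun i j => (hG i j).memLp_two
  have hcovX : ∀ i j i' j', cov[X i j, X i' j'; P] = if (i, j) = (i', j') then 1 else 0 := by
    intro i j i' j'
    split_ifs with h
    · obtain ⟨rfl, rfl⟩ := Prod.mk.inj h
      rw [covariance_self (hX i j).aemeasurable, (hX i j).variance_eq]
      simp
    · exact (hind.indepFun h).covariance_eq_zero (hL2 i j) (hL2 i' j')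
  have hcov : ∀ i i', cov[fun ω => ∑ j, a j * X i j ω, fun ω => ∑ j, a j * X i' j ω; P]
      = if i = i' then 1 else 0 := by
    intro i i'
    rw [covariance_fun_sum_fun_sum (fun j => (hL2 i j).const_mul _)
      (fun j => (hL2 i' j).const_mul _)]
    simp only [covariance_const_mul_left, covariance_const_mul_right, hcovX, Prod.mk.injEq]
    split_ifs with h
    · have ha' : ∑ j, a j * a j = 1 := by simpa only [sq] using ha
      simp [h, ha']
    · simp [h]
  refine ⟨fun i => ⟨?_, ?_⟩, hY.iIndepFun_of_covariance_eq_zero fun i i' h => ?_⟩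
  · exact Finset.aemeasurable_fun_sum _ fun j _ => (hX i j).aemeasurable.const_mul _
  · have hYi : HasGaussianLaw (fun ω => ∑ j, a j * X i j ω) P := by
      simpa using hY.map_fun (ContinuousLinearMap.proj i)
    have hmean : ∫ ω, ∑ j, a j * X i j ω ∂P = 0 := by
      rw [integral_finsetSum _ fun j _ => ((hG i j).integrable).const_mul _]
      refine Finset.sum_eq_zero fun j _ => ?_
      rw [integral_const_mul, (hX i j).integral_eq]
      simp
    rw [hYi.map_eq_gaussianReal, hmean, ← covariance_self hYi.aemeasurable, hcov]
    simp
  · rw [hcov, if_neg h]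

lemma lintegral_prod_comp_iid {Ω α : Type*} [MeasurableSpace Ω] {P : Measure Ω}
    [Fintype α] {Y : α → Ω → ℝ} {ν : Measure ℝ} (hY : ∀ i, HasLaw (Y i) ν P)
    (hind : iIndepFun Y P) {f : ℝ → ℝ≥0∞} (hf : Measurable f) :
    ∫⁻ ω, ∏ i, f (Y i ω) ∂P = (∫⁻ x, f x ∂ν) ^ Fintype.card α := by
  have hm := fun i => (hY i).aemeasurable
  have h1 : ∫⁻ ω, ∏ i, f (Y i ω) ∂P = ∫⁻ ω, ∏ i, f ((hm i).mk (Y i) ω) ∂P := by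
    refine lintegral_congr_ae ?_
    filter_upwards [ae_all_iff.2 fun i => (hm i).ae_eq_mk] with ω hω
    simp only [hω]
  have hind' : iIndepFun (fun i => (hm i).mk (Y i)) P :=
    (iIndepFun_congr fun i => (hm i).ae_eq_mk).1 hind
  rw [h1, lintegral_prod_eq_prod_lintegral_of_indepFun Finset.univ
    (fun i ω => f ((hm i).mk (Y i) ω)) (hind'.comp (fun _ => f) fun _ => hf)
    fun i => hf.comp (hm i).measurable_mk]
  rw [← Finset.card_univ, ← Finset.prod_const]
  refine Finset.prod_congr rfl fun i _ => ?_
  rw [← (hY i).map_eq, lintegral_map' hf.aemeasurable (hm i)]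
  refine lintegral_congr_ae ?_
  filter_upwards [(hm i).ae_eq_mk] with ω hω
  rw [hω]

lemma lintegral_gaussianReal_ofReal (f : ℝ → ℝ) (hf : Measurable f) :
    ∫⁻ x, ENNReal.ofReal (f x) ∂(gaussianReal 0 1)
      = ∫⁻ x, ENNReal.ofReal ((√(2 * Real.pi))⁻¹ * Real.exp (-x ^ 2 / 2) * f x) := by
  rw [gaussianReal_of_var_ne_zero _ one_ne_zero,
    lintegral_withDensity_eq_lintegral_mul _ (measurable_gaussianPDF _ _) hf.ennreal_ofReal]
  refine lintegral_congr fun x => ?_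
  rw [Pi.mul_apply, gaussianPDF, ← ENNReal.ofReal_mul (gaussianPDFReal_nonneg _ _ _)]
  simp [gaussianPDFReal]

lemma inv_sqrt_two_pi_le : (√(2 * Real.pi))⁻¹ ≤ 1 / 2 := by
  rw [inv_le_comm₀ (by positivity) (by norm_num)]
  refine Real.le_sqrt_of_sq_le ?_
  nlinarith [Real.pi_gt_three]

lemma lintegral_exp_neg_mul_abs_gaussianReal_le {l : ℝ} (hl : 0 < l) :
    ∫⁻ x, ENNReal.ofReal (Real.exp (-(l * |x|))) ∂(gaussianReal 0 1) ≤ ENNReal.ofReal (1 / l) := by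
  have hint : ∫ x : ℝ, Real.exp (-(l * |x|)) = 2 / l := by
    rw [integral_comp_abs (f := fun x => Real.exp (-(l * x)))]
    have := integral_exp_mul_Ioi (a := -l) (by linarith) 0
    simp only [neg_mul, mul_zero, Real.exp_zero] at this
    rw [this]; field_simp
  have hpos : Integrable fun x : ℝ => Real.exp (-(l * |x|)) := by
    by_contra h
    rw [integral_undef h] at hint
    have : 0 < 2 / l := by positivity
    linarith
  rw [lintegral_gaussianReal_ofReal _ (by fun_prop)]
  calc _ ≤ ∫⁻ x : ℝ, ENNReal.ofReal (1 / 2 * Real.exp (-(l * |x|))) := by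
        refine lintegral_mono fun x => ENNReal.ofReal_le_ofReal ?_
        gcongr
        have h1 : Real.exp (-x ^ 2 / 2) ≤ 1 := Real.exp_le_one_iff.2 (by nlinarith [sq_nonneg x])
        calc _ ≤ (√(2 * Real.pi))⁻¹ * 1 := by gcongr
          _ ≤ 1 / 2 := by rw [mul_one]; exact inv_sqrt_two_pi_le
    _ = ENNReal.ofReal (1 / l) := by
        rw [← ofReal_integral_eq_lintegral_ofReal (hpos.const_mul _)
          (Filter.Eventually.of_forall fun x => by positivity), integral_const_mul, hint]
        congr 1; ring

lemma lintegral_exp_sq_div_four_gaussianReal :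
    ∫⁻ x, ENNReal.ofReal (Real.exp (x ^ 2 / 4)) ∂(gaussianReal 0 1) = ENNReal.ofReal √2 := by
  rw [lintegral_gaussianReal_ofReal _ (by fun_prop)]
  have h : ∀ x : ℝ, (√(2 * Real.pi))⁻¹ * Real.exp (-x ^ 2 / 2) * Real.exp (x ^ 2 / 4)
      = (√(2 * Real.pi))⁻¹ * Real.exp (-(1 / 4) * x ^ 2) := by
    intro x
    rw [mul_assoc, ← Real.exp_add]; ring_nf
  simp only [h]
  rw [← ofReal_integral_eq_lintegral_ofReal
    ((integrable_exp_neg_mul_sq (by norm_num)).const_mul _)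
    (Filter.Eventually.of_forall fun x => by positivity), integral_const_mul, integral_gaussian]
  congr 1
  rw [← Real.sqrt_inv, ← Real.sqrt_mul (by positivity)]
  congr 1
  have := Real.pi_pos
  field_simp; norm_num

/-- The exponential moment of the squared excess over `t` is `1` up to a Gaussian tail, because
`(|x| - t)² ≤ x² - t²` for `|x| ≥ t`. -/
lemma lintegral_exp_sq_excess_gaussianReal_le {t : ℝ} (ht : 0 ≤ t) :
    ∫⁻ x, ENNReal.ofReal (Real.exp (max (|x| - t) 0 ^ 2 / 4)) ∂(gaussianReal 0 1)
      ≤ ENNReal.ofReal (1 + √2 * Real.exp (-(t ^ 2 / 4))) := by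
  calc _ ≤ ∫⁻ x, (1 + ENNReal.ofReal (Real.exp (-(t ^ 2 / 4))) *
          ENNReal.ofReal (Real.exp (x ^ 2 / 4))) ∂(gaussianReal 0 1) := by
        refine lintegral_mono fun x => ?_
        rw [← ENNReal.ofReal_mul (by positivity), ← ENNReal.ofReal_one,
          ← ENNReal.ofReal_add zero_le_one (by positivity)]
        refine ENNReal.ofReal_le_ofReal ?_
        rcases le_total (|x|) t with h | h
        · rw [max_eq_right (by linarith)]
          simp; positivity
        · rw [max_eq_left (by linarith), ← Real.exp_add]
          have : Real.exp ((|x| - t) ^ 2 / 4) ≤ Real.exp (-(t ^ 2 / 4) + x ^ 2 / 4) := by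
            refine Real.exp_le_exp.2 ?_
            rw [← sq_abs x]
            nlinarith
          linarith
    _ = _ := by
        rw [lintegral_add_left measurable_const, lintegral_const_mul _ (by fun_prop),
          lintegral_exp_sq_div_four_gaussianReal, ← ENNReal.ofReal_mul (by positivity)]
        simp only [lintegral_const, measure_univ, mul_one]
        rw [← ENNReal.ofReal_one, ← ENNReal.ofReal_add zero_le_one (by positivity), mul_comm]

/-- Exponential Markov inequality for a sum of i.i.d. terms. The event need not be measurable. -/
lemma measure_sum_ge_le_exp_mul_pow {Ω α : Type*} [MeasurableSpace Ω] {P : Measure Ω}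
    [Fintype α] {Y : α → Ω → ℝ} {ν : Measure ℝ} (hY : ∀ i, HasLaw (Y i) ν P)
    (hind : iIndepFun Y P) {f : ℝ → ℝ} (hf : Measurable f) {b c : ℝ} (hb : 0 ≤ b)
    (hfb : ∫⁻ x, ENNReal.ofReal (Real.exp (f x)) ∂ν ≤ ENNReal.ofReal b) :
    P {ω | c ≤ ∑ i, f (Y i ω)} ≤ ENNReal.ofReal (Real.exp (-c) * b ^ Fintype.card α) := by
  have h1 : ∫⁻ ω, ∏ i, ENNReal.ofReal (Real.exp (f (Y i ω))) ∂P
      ≤ ENNReal.ofReal (b ^ Fintype.card α) := by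
    rw [lintegral_prod_comp_iid hY hind (f := fun x => ENNReal.ofReal (Real.exp (f x)))
      (by fun_prop), ENNReal.ofReal_pow hb]
    gcongr
  have hmeas : AEMeasurable (fun ω => ∏ i, ENNReal.ofReal (Real.exp (f (Y i ω)))) P := by
    refine Finset.aemeasurable_fun_prod _ fun i _ => ?_
    exact (by fun_prop : Measurable fun x => ENNReal.ofReal (Real.exp (f x))).comp_aemeasurable
      (hY i).aemeasurable
  have hsub : {ω | c ≤ ∑ i, f (Y i ω)}
      ⊆ {ω | ENNReal.ofReal (Real.exp c) ≤ ∏ i, ENNReal.ofReal (Real.exp (f (Y i ω)))} := by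
    intro ω hω
    simp only [Set.mem_ofPred_eq] at hω ⊢
    rw [← ENNReal.ofReal_prod_of_nonneg fun i _ => by positivity, ← Real.exp_sum]
    exact ENNReal.ofReal_le_ofReal (Real.exp_le_exp.2 hω)
  have h2 := (mul_meas_ge_le_lintegral₀ hmeas (ENNReal.ofReal (Real.exp c))).trans h1
  calc P {ω | c ≤ ∑ i, f (Y i ω)}
      = ENNReal.ofReal (Real.exp (-c)) *
          (ENNReal.ofReal (Real.exp c) * P {ω | c ≤ ∑ i, f (Y i ω)}) := by
        rw [← mul_assoc, ← ENNReal.ofReal_mul (by positivity), ← Real.exp_add]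
        simp
    _ ≤ ENNReal.ofReal (Real.exp (-c)) * ENNReal.ofReal (b ^ Fintype.card α) := by
        gcongr
        exact le_trans (by gcongr) h2
    _ = _ := by rw [ENNReal.ofReal_mul (by positivity)]

lemma measure_sum_abs_gaussian_le {Ω α : Type*} [MeasurableSpace Ω] {P : Measure Ω}
    [Fintype α] {Y : α → Ω → ℝ} (hY : ∀ i, HasLaw (Y i) (gaussianReal 0 1) P)
    (hind : iIndepFun Y P) :
    P {ω | ∑ i, |Y i ω| ≤ Fintype.card α / 100}
      ≤ ENNReal.ofReal (Real.exp (-(3 * Fintype.card α))) := by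
  have h := measure_sum_ge_le_exp_mul_pow hY hind (f := fun x => -(100 * |x|)) (by fun_prop)
    (b := 1 / 100) (c := -Fintype.card α) (by norm_num)
    (lintegral_exp_neg_mul_abs_gaussianReal_le (by norm_num))
  refine le_trans (measure_mono fun ω hω => ?_) (h.trans (ENNReal.ofReal_le_ofReal ?_))
  · simp only [Set.mem_ofPred_eq, Finset.sum_neg_distrib, ← Finset.mul_sum] at hω ⊢
    linarith
  -- Each term gains `1 / 100 ≤ e⁻⁴` and loses a factor `e` to the threshold `card α / 100`.
  · have h100 : (1 / 100 : ℝ) ≤ Real.exp (-4) := by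
      rw [Real.exp_neg, one_div]
      gcongr
      calc Real.exp 4 = Real.exp 1 ^ 4 := by rw [← Real.exp_nat_mul]; norm_num
        _ ≤ 2.7182818286 ^ 4 := by gcongr; exact Real.exp_one_lt_d9.le
        _ ≤ 100 := by norm_num
    calc _ ≤ Real.exp (-(-(Fintype.card α : ℝ))) * Real.exp (-4) ^ Fintype.card α := by gcongr
      _ = _ := by rw [← Real.exp_nat_mul, ← Real.exp_add]; ring_nf

lemma measure_sum_sq_excess_gaussian_ge {Ω α : Type*} [MeasurableSpace Ω] {P : Measure Ω}
    [Fintype α] {Y : α → Ω → ℝ} (hY : ∀ i, HasLaw (Y i) (gaussianReal 0 1) P)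
    (hind : iIndepFun Y P) {t : ℝ} (ht : 0 ≤ t) (r : ℝ) :
    P {ω | r ≤ ∑ i, max (|Y i ω| - t) 0 ^ 2}
      ≤ ENNReal.ofReal (Real.exp (√2 * Real.exp (-(t ^ 2 / 4)) * Fintype.card α - r / 4)) := by
  have h := measure_sum_ge_le_exp_mul_pow hY hind (f := fun x => max (|x| - t) 0 ^ 2 / 4) (by fun_prop)
    (b := 1 + √2 * Real.exp (-(t ^ 2 / 4))) (c := r / 4) (by positivity)
    (lintegral_exp_sq_excess_gaussianReal_le ht)
  refine le_trans (measure_mono fun ω hω => ?_) (h.trans (ENNReal.ofReal_le_ofReal ?_))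
  · simp only [Set.mem_ofPred_eq, ← Finset.sum_div] at hω ⊢
    linarith
  · calc _ ≤ Real.exp (-(r / 4)) * Real.exp (√2 * Real.exp (-(t ^ 2 / 4))) ^ Fintype.card α := by
          gcongr
          rw [add_comm]; exact Real.add_one_le_exp _
      _ = _ := by rw [← Real.exp_nat_mul, ← Real.exp_add]; ring_nf

/-! ### Integer points of the `ℓ₁` ball -/

/-- The integer points of the `ℓ_1` ball of radius `M` in `ℝ^N`. -/
noncomputable def latticeBall (N M : ℕ) : Finset (Fin N → ℤ) :=
  (Fintype.piFinset fun _ => Finset.Icc (-(M : ℤ)) M).filter fun n => ∑ i, |n i| ≤ (M : ℤ)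

lemma mem_latticeBall {N M : ℕ} {n : Fin N → ℤ} : n ∈ latticeBall N M ↔ ∑ i, |n i| ≤ (M : ℤ) := by
  simp only [latticeBall, Finset.mem_filter, Fintype.mem_piFinset, Finset.mem_Icc,
    and_iff_right_iff_imp, ← abs_le]
  intro h i
  exact (Finset.single_le_sum (fun j _ => abs_nonneg (n j)) (Finset.mem_univ i)).trans h

lemma sum_Icc_pow_natAbs_le {r : ℝ} (hr0 : 0 ≤ r) (hr1 : r < 1) (M : ℕ) :
    ∑ j ∈ Finset.Icc (-(M : ℤ)) M, r ^ j.natAbs ≤ (1 + r) / (1 - r) := by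
  have h1 : HasSum (fun n : ℕ => r ^ (n : ℤ).natAbs) (1 - r)⁻¹ := by
    simpa using hasSum_geometric_of_lt_one hr0 hr1
  have h2 : HasSum (fun n : ℕ => r ^ (-((n : ℤ) + 1)).natAbs) (r * (1 - r)⁻¹) := by
    have h := (hasSum_geometric_of_lt_one hr0 hr1).mul_left r
    have e : (fun n : ℕ => r ^ (-((n : ℤ) + 1)).natAbs) = fun n : ℕ => r * r ^ n := by
      ext n
      rw [Int.natAbs_neg, ← pow_succ']
      congr 1
    rw [e]; exact h
  have h := HasSum.of_nat_of_neg_add_one (f := fun j : ℤ => r ^ j.natAbs) h1 h2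
  refine (sum_le_hasSum _ (fun j _ => by positivity) h).trans (le_of_eq ?_)
  field_simp

/-- Chernoff-type counting: on the ball `r ^ M ≤ r ^ ‖n‖₁`, and `∑ r ^ ‖n‖₁` over all integer vectors
factors over the coordinates. -/
lemma card_latticeBall_le {N M : ℕ} {r : ℝ} (hr0 : 0 < r) (hr1 : r < 1) :
    ((latticeBall N M).card : ℝ) ≤ (r ^ M)⁻¹ * ((1 + r) / (1 - r)) ^ N := by
  have key : r ^ M * (latticeBall N M).card ≤ ((1 + r) / (1 - r)) ^ N := by
    calc r ^ M * (latticeBall N M).card = ∑ n ∈ latticeBall N M, r ^ M := by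
          rw [Finset.sum_const, nsmul_eq_mul, mul_comm]
      _ ≤ ∑ n ∈ latticeBall N M, ∏ i, r ^ (n i).natAbs := by
          refine Finset.sum_le_sum fun n hn => ?_
          rw [Finset.prod_pow_eq_pow_sum]
          refine pow_le_pow_of_le_one hr0.le hr1.le ?_
          have := mem_latticeBall.1 hn
          zify
          exact this
      _ ≤ ∑ n ∈ Fintype.piFinset fun _ : Fin N => Finset.Icc (-(M : ℤ)) M,
            ∏ i, r ^ (n i).natAbs := by
          refine Finset.sum_le_sum_of_subset_of_nonneg (Finset.filter_subset _ _) ?_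
          intro n _ _
          positivity
      _ = ∏ _i : Fin N, ∑ j ∈ Finset.Icc (-(M : ℤ)) M, r ^ j.natAbs :=
          by
          rw [Finset.prod_univ_sum]
      _ = (∑ j ∈ Finset.Icc (-(M : ℤ)) M, r ^ j.natAbs) ^ N := by
          rw [Finset.prod_const, Finset.card_univ, Fintype.card_fin]
      _ ≤ _ := by
          gcongr
          exact sum_Icc_pow_natAbs_le hr0.le hr1 M
  rw [inv_mul_eq_div, le_div_iff₀ (by positivity), mul_comm]
  exact key

lemma card_latticeBall_le_exp {N s : ℕ} (hs : 1 ≤ s) (hsN : s ≤ N) (M : ℕ) :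
    ((latticeBall N M).card : ℝ)
      ≤ Real.exp (M * Real.log (Real.exp 1 * N / s) + 2 * s) := by
  have hs0 : (0 : ℝ) < s := by exact_mod_cast hs
  have hN0 : (0 : ℝ) < N := by exact_mod_cast hs.trans hsN
  have hsN' : (s : ℝ) ≤ N := by exact_mod_cast hsN
  have he : (2 : ℝ) ≤ Real.exp 1 := by have := Real.add_one_le_exp (1 : ℝ); linarith
  -- The weight `r = s / (e N)` makes the product over the coordinates at most `exp (2 s)`.
  set q : ℝ := Real.exp 1 * N / s with hq
  have hq0 : 0 < q := by positivity
  have hq2 : 2 ≤ q := by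
    rw [hq, le_div_iff₀ hs0]
    calc 2 * (s : ℝ) ≤ 2 * N := by linarith
      _ ≤ _ := by gcongr
  have hqs : q⁻¹ * N ≤ s / 2 := by
    rw [hq, inv_div, div_mul_eq_mul_div, div_le_div_iff₀ (by positivity) (by norm_num)]
    have := mul_pos hs0 hN0
    nlinarith
  have hr : q⁻¹ ≤ 1 / 2 := by
    rw [one_div]; exact inv_anti₀ (by norm_num) hq2
  refine (card_latticeBall_le (N := N) (M := M) (inv_pos.2 hq0) (by linarith)).trans ?_
  have h1 : ((q⁻¹) ^ M)⁻¹ = Real.exp (M * Real.log q) := by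
    rw [inv_pow, inv_inv, mul_comm, ← Real.rpow_def_of_pos hq0, Real.rpow_natCast]
  have h2 : (1 + q⁻¹) / (1 - q⁻¹) ≤ Real.exp (4 * q⁻¹) := by
    refine le_trans ?_ (Real.add_one_le_exp _)
    rw [div_le_iff₀ (by linarith)]
    have := inv_pos.2 hq0
    nlinarith
  rw [h1, Real.exp_add]
  gcongr
  have h0 : 0 ≤ (1 + q⁻¹) / (1 - q⁻¹) :=
    div_nonneg (by positivity) (by linarith)
  calc _ ≤ Real.exp (4 * q⁻¹) ^ N := by gcongr
    _ = Real.exp (4 * (q⁻¹ * N)) := by rw [← Real.exp_nat_mul]; ring_nf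
    _ ≤ _ := Real.exp_le_exp.2 (by linarith)

/-! ### Elementary properties of `ℓ_p` norms -/

lemma ellNorm_one_eq {n : ℕ} (v : Fin n → ℝ) : ellNorm 1 v = ∑ i, |v i| := by
  simp [ellNorm, PiLp.norm_eq_of_L1]

lemma ellNorm_two_eq {n : ℕ} (v : Fin n → ℝ) : ellNorm 2 v = √(∑ i, v i ^ 2) := by
  simp [ellNorm, PiLp.norm_eq_of_L2]

lemma ellNorm_two_sq {n : ℕ} (v : Fin n → ℝ) : ellNorm 2 v ^ 2 = ∑ i, v i ^ 2 := by
  rw [ellNorm_two_eq, Real.sq_sqrt (Finset.sum_nonneg fun i _ => sq_nonneg _)]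

lemma ellNorm_nonneg {n : ℕ} {p : ℝ≥0∞} (hp : 1 ≤ p) (v : Fin n → ℝ) : 0 ≤ ellNorm p v :=
  have : Fact (1 ≤ p) := ⟨hp⟩
  norm_nonneg _

lemma ellNorm_add_le {n : ℕ} {p : ℝ≥0∞} (hp : 1 ≤ p) (v w : Fin n → ℝ) :
    ellNorm p (v + w) ≤ ellNorm p v + ellNorm p w :=
  have : Fact (1 ≤ p) := ⟨hp⟩
  norm_add_le (WithLp.toLp p v) (WithLp.toLp p w)

lemma ellNorm_smul {n : ℕ} {p : ℝ≥0∞} (hp : 1 ≤ p) (c : ℝ) (v : Fin n → ℝ) :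
    ellNorm p (c • v) = |c| * ellNorm p v :=
  have : Fact (1 ≤ p) := ⟨hp⟩
  norm_smul c (WithLp.toLp p v)

lemma ellNorm_neg {n : ℕ} {p : ℝ≥0∞} (hp : 1 ≤ p) (v : Fin n → ℝ) :
    ellNorm p (-v) = ellNorm p v :=
  have : Fact (1 ≤ p) := ⟨hp⟩
  norm_neg (WithLp.toLp p v)

/-- Hölder's inequality `‖v‖₁ ≤ m ^ (1 - 1/p) ‖v‖_p`; for `p = ∞` the exponent `(p⁻¹).toReal`
is `0`. -/
lemma ellNorm_one_le_ellNorm_mul {m : ℕ} (hm : 0 < m) {p : ℝ≥0∞} (hp : 1 ≤ p) (v : Fin m → ℝ) :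
    ellNorm 1 v ≤ m / (m : ℝ) ^ (p⁻¹).toReal * ellNorm p v := by
  have hm0 : (0 : ℝ) < m := by exact_mod_cast hm
  rcases eq_or_ne p ∞ with rfl | hp'
  · rw [ellNorm_one_eq]
    have h : ∀ i, |v i| ≤ ellNorm ∞ v := fun i => by
      have := PiLp.norm_apply_le (WithLp.toLp ∞ v) i
      simpa [ellNorm] using this
    calc ∑ i, |v i| ≤ ∑ _i : Fin m, ellNorm ∞ v := Finset.sum_le_sum fun i _ => h i
      _ = _ := by simp
  · have hq : 1 ≤ p.toReal := by
      simpa using ENNReal.toReal_mono hp' hp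
    have hq0 : 0 < p.toReal := by linarith
    have hS : 0 ≤ ∑ i, |v i| := Finset.sum_nonneg fun i _ => abs_nonneg _
    have hS' : 0 ≤ ∑ i, |v i| ^ p.toReal := Finset.sum_nonneg fun i _ => by positivity
    have h := Real.rpow_sum_le_const_mul_sum_rpow Finset.univ v hq
    rw [Finset.card_univ, Fintype.card_fin] at h
    have h2 := Real.rpow_le_rpow (by positivity) h (one_div_nonneg.2 hq0.le)
    rw [← Real.rpow_mul hS, mul_one_div_cancel hq0.ne', Real.rpow_one,
      Real.mul_rpow (by positivity) hS', ← Real.rpow_mul hm0.le] at h2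
    rw [ellNorm_one_eq, ellNorm, PiLp.norm_eq_sum hq0, ENNReal.toReal_inv]
    simp only [Real.norm_eq_abs]
    refine h2.trans (le_of_eq ?_)
    congr 1
    nth_rw 2 [← Real.rpow_one (m : ℝ)]
    rw [← Real.rpow_sub hm0]
    congr 1
    field_simp

/-! ### Tail bounds for one vector -/

namespace IsStandardGaussianMatrix

variable {Ω : Type*} [MeasurableSpace Ω] {P : Measure Ω} {m N : ℕ}
  {Φ : Ω → Matrix (Fin m) (Fin N) ℝ}

lemma measure_ellNorm_one_mulVec_le (hΦ : IsStandardGaussianMatrix P Φ) {v : Fin N → ℝ}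
    (hv : v ≠ 0) :
    P {ω | ellNorm 1 (Φ ω *ᵥ v) ≤ m / 100 * ellNorm 2 v} ≤ ENNReal.ofReal (Real.exp (-(3 * m))) := by
  have h0 : 0 < ellNorm 2 v := by
    refine lt_of_le_of_ne (ellNorm_nonneg (by norm_num) v) fun h => hv ?_
    have : ∑ i, v i ^ 2 = 0 := by rw [← ellNorm_two_sq, ← h]; simp
    rw [Finset.sum_eq_zero_iff_of_nonneg fun i _ => sq_nonneg _] at this
    ext i
    simpa using this i (Finset.mem_univ i)
  obtain ⟨h1, h2⟩ := iid_gaussian_sum_mul_of_sum_sq_eq_one hΦ.hasLaw hΦ.indep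
    (a := fun j => v j / ellNorm 2 v) (by
      simp only [div_pow, ← Finset.sum_div, ← ellNorm_two_sq]
      field_simp)
  have h := measure_sum_abs_gaussian_le h1 h2
  simp only [Fintype.card_fin] at h
  refine (measure_mono fun ω hω => ?_).trans h
  simp only [Set.mem_ofPred_eq, ellNorm_one_eq] at hω ⊢
  have e : ∀ i, |∑ j, v j / ellNorm 2 v * Φ ω i j| = |(Φ ω *ᵥ v) i| / ellNorm 2 v := by
    intro i
    rw [← abs_of_pos h0, ← abs_div, abs_of_pos h0, Matrix.mulVec, dotProduct, Finset.sum_div]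
    congr 1
    exact Finset.sum_congr rfl fun j _ => by ring
  simp only [e, ← Finset.sum_div]
  rwa [div_le_iff₀ h0]

lemma measure_sum_sq_excess_vecMul_ge (hΦ : IsStandardGaussianMatrix P Φ) (hm : 0 < m)
    {σ : Fin m → ℝ} (hσ : ∀ i, σ i ^ 2 = 1) {t : ℝ} (ht : 0 ≤ t) (r : ℝ) :
    P {ω | r ≤ ∑ j, max (|(σ ᵥ* Φ ω) j| / √m - t) 0 ^ 2}
      ≤ ENNReal.ofReal (Real.exp (√2 * Real.exp (-(t ^ 2 / 4)) * N - r / 4)) := by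
  have hm0 : (0 : ℝ) < m := by exact_mod_cast hm
  obtain ⟨h1, h2⟩ := iid_gaussian_sum_mul_of_sum_sq_eq_one (X := fun j i ω => Φ ω i j)
    (fun j i => hΦ.hasLaw i j) (hΦ.indep.precomp (g := Prod.swap) Prod.swap_injective)
    (a := fun i => σ i / √m) (by
      simp only [div_pow, hσ, Real.sq_sqrt hm0.le]
      simp [hm0.ne'])
  have h := measure_sum_sq_excess_gaussian_ge h1 h2 ht r
  simp only [Fintype.card_fin] at h
  refine (measure_mono fun ω hω => ?_).trans h
  simp only [Set.mem_ofPred_eq] at hω ⊢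
  have e : ∀ j, |∑ i, σ i / √m * Φ ω i j| = |(σ ᵥ* Φ ω) j| / √m := by
    intro j
    rw [← abs_of_pos (Real.sqrt_pos.2 hm0), ← abs_div, abs_of_pos (Real.sqrt_pos.2 hm0),
      Matrix.vecMul, dotProduct, Finset.sum_div]
    congr 1
    exact Finset.sum_congr rfl fun j _ => by ring
  simp only [e]
  exact hω

end IsStandardGaussianMatrix

/-! ### From finitely many inequalities to the cone -/

/-- Duality turns a bound on the parts of `Φᵀ σ / √m` exceeding `t`, uniform over sign vectors `σ`,
into an upper bound on `‖Φ v‖₁` for every `v`. -/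
lemma ellNorm_one_mulVec_le_of_sq_excess_le {m N : ℕ} (hm : 0 < m)
    {Φ : Matrix (Fin m) (Fin N) ℝ} {t c : ℝ} (hc : 0 ≤ c)
    (hΦ : ∀ σ : Fin m → ℝ, (∀ i, σ i = 1 ∨ σ i = -1) →
      ∑ j, max (|(σ ᵥ* Φ) j| / √m - t) 0 ^ 2 ≤ c ^ 2 * m) (v : Fin N → ℝ) :
    ellNorm 1 (Φ *ᵥ v) ≤ √m * (c * √m * ellNorm 2 v + t * ellNorm 1 v) := by
  have hm0 : (0 : ℝ) < √m := Real.sqrt_pos.2 (by exact_mod_cast hm)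
  set σ : Fin m → ℝ := fun i => if 0 ≤ (Φ *ᵥ v) i then 1 else -1 with hσ
  have h1 : ellNorm 1 (Φ *ᵥ v) = ∑ j, (σ ᵥ* Φ) j * v j := by
    have : ellNorm 1 (Φ *ᵥ v) = σ ⬝ᵥ (Φ *ᵥ v) := by
      rw [ellNorm_one_eq, dotProduct]
      refine Finset.sum_congr rfl fun i _ => ?_
      simp only [hσ]
      split_ifs with h
      · rw [abs_of_nonneg h, one_mul]
      · rw [abs_of_neg (not_le.1 h)]; ring
    rw [this, Matrix.dotProduct_mulVec, dotProduct]
  set g : Fin N → ℝ := fun j => max (|(σ ᵥ* Φ) j| / √m - t) 0 with hg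
  have hgb : ∀ j, (σ ᵥ* Φ) j * v j ≤ √m * (g j * |v j| + t * |v j|) := by
    intro j
    have hj : |(σ ᵥ* Φ) j| ≤ √m * (g j + t) := by
      have : |(σ ᵥ* Φ) j| / √m ≤ g j + t := by
        have := le_max_left (|(σ ᵥ* Φ) j| / √m - t) 0
        simp only [hg]; linarith
      rwa [div_le_iff₀' hm0] at this
    calc _ ≤ |(σ ᵥ* Φ) j * v j| := le_abs_self _
      _ = |(σ ᵥ* Φ) j| * |v j| := abs_mul _ _
      _ ≤ √m * (g j + t) * |v j| := by gcongr
      _ = _ := by ring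
  have hcs : ∑ j, g j * |v j| ≤ c * √m * ellNorm 2 v := by
    refine (Real.sum_mul_le_sqrt_mul_sqrt _ _ _).trans ?_
    simp only [sq_abs]
    rw [ellNorm_two_eq]
    gcongr
    refine Real.sqrt_le_iff.2 ⟨by positivity, ?_⟩
    rw [mul_pow, Real.sq_sqrt (by positivity)]
    exact hΦ σ fun i => by simp only [hσ]; split_ifs <;> simp
  rw [h1]
  calc _ ≤ ∑ j, √m * (g j * |v j| + t * |v j|) := Finset.sum_le_sum fun j _ => hgb j
    _ = √m * (∑ j, g j * |v j| + t * ellNorm 1 v) := by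
        rw [← Finset.mul_sum, Finset.sum_add_distrib, ← Finset.mul_sum, ellNorm_one_eq]
    _ ≤ _ := by gcongr

lemma exists_int_toward_zero (x : ℝ) : ∃ n : ℤ, |(n : ℝ)| ≤ |x| ∧ |x - n| ≤ 1 ∧ |x - n| ≤ |x| := by
  rcases le_total 0 x with hx | hx
  · refine ⟨⌊x⌋, ?_⟩
    have h0 : (0 : ℝ) ≤ ⌊x⌋ := by exact_mod_cast Int.floor_nonneg.2 hx
    have h1 := Int.floor_le x
    have h2 := Int.lt_floor_add_one x
    rw [abs_of_nonneg h0, abs_of_nonneg hx, abs_of_nonneg (by linarith)]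
    exact ⟨h1, by linarith, by linarith⟩
  · refine ⟨⌈x⌉, ?_⟩
    have h0 : (⌈x⌉ : ℝ) ≤ 0 := by exact_mod_cast Int.ceil_le.2 (by simpa using hx)
    have h1 := Int.le_ceil x
    have h2 := Int.ceil_lt_add_one x
    rw [abs_of_nonpos h0, abs_of_nonpos hx, abs_of_nonpos (by linarith)]
    exact ⟨by linarith, by linarith, by linarith⟩

/-- The upper bound `hU` for all vectors and the lower bound `hL` for integer vectors give a lower
bound on the cone `‖h‖₁ ≤ 3 √s ‖h‖₂`, by rounding `h` toward zero. -/
lemma lower_bound_on_cone {m N s : ℕ} (hs : 1 ≤ s) {Φ : Matrix (Fin m) (Fin N) ℝ}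
    (hU : ∀ v, ellNorm 1 (Φ *ᵥ v) ≤ 4 * m * (ellNorm 2 v + ellNorm 1 v / (9600 * √s)))
    (hL : ∀ n ∈ latticeBall N (92160000 * s), n ≠ 0 →
      m / 100 * ellNorm 2 (fun j => (n j : ℝ)) ≤ ellNorm 1 (Φ *ᵥ fun j => (n j : ℝ)))
    {h : Fin N → ℝ} (hh : ellNorm 1 h ≤ 3 * √s * ellNorm 2 h) :
    m / 200 * ellNorm 2 h ≤ ellNorm 1 (Φ *ᵥ h) := by
  have hm0 : (0 : ℝ) ≤ m := by positivity
  have hs0 : (0 : ℝ) < s := by exact_mod_cast hs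
  have hss : √(s : ℝ) * √s = s := Real.mul_self_sqrt hs0.le
  have hsq : 0 < √(s : ℝ) := Real.sqrt_pos.2 hs0
  have hp1 : (1 : ℝ≥0∞) ≤ 2 := by norm_num
  rcases (ellNorm_nonneg hp1 h).eq_or_lt with hH | hH
  · rw [← hH, mul_zero]; exact ellNorm_nonneg le_rfl _
  set H := ellNorm 2 h with hHdef
  -- The mesh is chosen so that `β ‖h‖₁ ≤ (H / 3200)²` on the cone.
  set β : ℝ := H / (30720000 * √s) with hβ
  have hβ0 : 0 < β := by positivity
  choose n hn1 hn2 hn3 using fun j => exists_int_toward_zero (h j / β)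
  set w : Fin N → ℝ := fun j => h j - β * n j with hw
  have hwe : ∀ j, |w j| = β * |h j / β - n j| := by
    intro j
    rw [← abs_of_pos hβ0, ← abs_mul, abs_of_pos hβ0]
    congr 1
    simp only [hw]; field_simp
  have hw1 : ∀ j, |w j| ≤ β := fun j => by
    rw [hwe]; exact mul_le_of_le_one_right hβ0.le (hn2 j)
  have hw2 : ∀ j, |w j| ≤ |h j| := fun j => by
    rw [hwe]
    calc _ ≤ β * |h j / β| := mul_le_mul_of_nonneg_left (hn3 j) hβ0.le
      _ = |h j| := by rw [abs_div, abs_of_pos hβ0]; field_simp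
  have hwl1 : ellNorm 1 w ≤ 3 * √s * H := by
    refine le_trans ?_ hh
    rw [ellNorm_one_eq, ellNorm_one_eq]
    exact Finset.sum_le_sum fun j _ => hw2 j
  have hwl2 : ellNorm 2 w ≤ H / 3200 := by
    refine le_of_sq_le_sq ?_ (by positivity)
    rw [ellNorm_two_sq]
    calc ∑ j, w j ^ 2 ≤ ∑ j, β * |h j| := by
          refine Finset.sum_le_sum fun j _ => ?_
          rw [← sq_abs, sq]
          exact mul_le_mul (hw1 j) (hw2 j) (abs_nonneg _) hβ0.le
      _ = β * ellNorm 1 h := by rw [← Finset.mul_sum, ellNorm_one_eq]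
      _ ≤ β * (3 * √s * H) := by gcongr
      _ = (H / 3200) ^ 2 := by rw [hβ]; field_simp; norm_num
  have hball : n ∈ latticeBall N (92160000 * s) := by
    rw [mem_latticeBall]
    have : ∑ j, |(n j : ℝ)| ≤ 92160000 * s := by
      calc ∑ j, |(n j : ℝ)| ≤ ∑ j, |h j| / β := by
            refine Finset.sum_le_sum fun j _ => (hn1 j).trans (le_of_eq ?_)
            rw [abs_div, abs_of_pos hβ0]
        _ = ellNorm 1 h / β := by rw [← Finset.sum_div, ellNorm_one_eq]
        _ ≤ 3 * √s * H / β := by gcongr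
        _ = 92160000 * (√s * √s) := by rw [hβ]; field_simp; norm_num
        _ = _ := by rw [hss]
    exact_mod_cast this
  have hdec : h = β • (fun j => (n j : ℝ)) + w := by
    ext j; simp [hw]
  have hq : H - H / 3200 ≤ β * ellNorm 2 (fun j => (n j : ℝ)) := by
    have h1 := ellNorm_add_le hp1 (β • fun j => (n j : ℝ)) w
    rw [← hdec, ellNorm_smul hp1, abs_of_pos hβ0, ← hHdef] at h1
    linarith
  have hn0 : n ≠ 0 := by
    rintro rfl
    have : ellNorm 2 (fun j : Fin N => (((0 : Fin N → ℤ) j : ℤ) : ℝ)) = 0 := by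
      simp [ellNorm_two_eq]
    rw [this, mul_zero] at hq
    linarith
  have hlow := hL n hball hn0
  have hup := hU w
  have hmid : β * ellNorm 1 (Φ *ᵥ fun j => (n j : ℝ)) ≤ ellNorm 1 (Φ *ᵥ h) + ellNorm 1 (Φ *ᵥ w) := by
    have h1 := ellNorm_add_le le_rfl (Φ *ᵥ h) (-(Φ *ᵥ w))
    rw [ellNorm_neg le_rfl, ← sub_eq_add_neg, ← Matrix.mulVec_sub] at h1
    have h2 : h - w = β • fun j => (n j : ℝ) := by rw [sub_eq_iff_eq_add]; exact hdec
    rwa [h2, Matrix.mulVec_smul, ellNorm_smul le_rfl, abs_of_pos hβ0] at h1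
  have hup' : ellNorm 1 (Φ *ᵥ w) ≤ m * (H / 400) := by
    refine hup.trans ?_
    calc 4 * (m : ℝ) * (ellNorm 2 w + ellNorm 1 w / (9600 * √s))
        ≤ 4 * m * (H / 3200 + 3 * √s * H / (9600 * √s)) := by gcongr
      _ = _ := by field_simp; ring
  have hlow' : (m : ℝ) * ((H - H / 3200) / 100) ≤ β * ellNorm 1 (Φ *ᵥ fun j => (n j : ℝ)) := by
    calc (m : ℝ) * ((H - H / 3200) / 100)
        ≤ m * ((β * ellNorm 2 (fun j => (n j : ℝ))) / 100) := by gcongr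
      _ = β * (m / 100 * ellNorm 2 (fun j => (n j : ℝ))) := by ring
      _ ≤ _ := by gcongr
  have : 0 ≤ (m : ℝ) * H := by positivity
  linarith

/-! ### Stable recovery from the lower bound on the cone -/

/-- If adding `h` to `x` does not increase the `ℓ₁` norm, then the part of `h` off the support of any
`s`-sparse `z` is dominated by the part on it, up to `2 ‖x - z‖₁`. -/
lemma ellNorm_one_le_of_ellNorm_one_add_le {N s : ℕ} {x h : Fin N → ℝ}
    (hxh : ellNorm 1 (x + h) ≤ ellNorm 1 x) :
    ellNorm 1 h ≤ 2 * √s * ellNorm 2 h + 2 * bestApproxError s x := by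
  have hne : ((fun z : Fin N → ℝ => ellNorm 1 (x - z)) '' {z | hammingNorm z ≤ s}).Nonempty :=
    ⟨_, 0, by simp, rfl⟩
  suffices H : (ellNorm 1 h - 2 * √s * ellNorm 2 h) / 2 ≤ bestApproxError s x by linarith
  refine le_csInf hne ?_
  rintro _ ⟨z, hz, rfl⟩
  set T : Finset (Fin N) := Finset.univ.filter fun i => z i ≠ 0 with hT
  have hcard : (T.card : ℝ) ≤ s := by exact_mod_cast hz
  have hTs : ∑ i ∈ T, |h i| ≤ √s * ellNorm 2 h := by
    calc ∑ i ∈ T, |h i| = ∑ i ∈ T, 1 * |h i| := by simp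
      _ ≤ √(∑ _i ∈ T, 1 ^ 2) * √(∑ i ∈ T, |h i| ^ 2) := Real.sum_mul_le_sqrt_mul_sqrt _ _ _
      _ ≤ √s * ellNorm 2 h := by
        rw [ellNorm_two_eq]
        gcongr
        · simpa using hcard
        · simp only [sq_abs]
          exact Finset.sum_le_sum_of_subset_of_nonneg (Finset.subset_univ _)
            fun i _ _ => sq_nonneg _
  have hpt : ∀ i, |x i| + |h i| ≤
      |x i + h i| + 2 * |x i - z i| + 2 * if z i ≠ 0 then |h i| else 0 := by
    intro i
    have h1 : |x i| ≤ |x i - z i| + |z i| := by simpa using abs_add_le (x i - z i) (z i)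
    have h2 : |z i + h i| ≤ |x i + h i| + |x i - z i| := by
      have := abs_sub (x i + h i) (x i - z i)
      rwa [show x i + h i - (x i - z i) = z i + h i by ring] at this
    split_ifs with hz0
    · have h3 : |z i| ≤ |z i + h i| + |h i| := by
        have := abs_sub (z i + h i) (h i)
        rwa [add_sub_cancel_right] at this
      linarith
    · have hz0' : z i = 0 := not_not.1 hz0
      rw [hz0', abs_zero] at h1
      rw [hz0', zero_add] at h2
      rw [hz0']
      linarith
  have hsum := Finset.sum_le_sum fun i (_ : i ∈ Finset.univ) => hpt i
  simp only [Finset.sum_add_distrib, ← Finset.mul_sum, ← Finset.sum_filter] at hsum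
  have e1 : ellNorm 1 (x + h) = ∑ i, |x i + h i| := ellNorm_one_eq _
  have e2 : ellNorm 1 (x - z) = ∑ i, |x i - z i| := ellNorm_one_eq _
  show _ ≤ ellNorm 1 (x - z)
  rw [e2]
  rw [e1, ellNorm_one_eq] at hxh
  rw [ellNorm_one_eq]
  linarith

lemma one_le_log_exp_one_mul_div {N s : ℕ} (hs : 1 ≤ s) (hsN : s ≤ N) :
    1 ≤ Real.log (Real.exp 1 * N / s) := by
  have hs0 : (0 : ℝ) < s := by exact_mod_cast hs
  have hN0 : (0 : ℝ) < N := by exact_mod_cast hs.trans hsN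
  rw [Real.le_log_iff_exp_le (by positivity), le_div_iff₀ hs0]
  gcongr

lemma bestApproxError_nonneg {N : ℕ} (s : ℕ) (x : Fin N → ℝ) : 0 ≤ bestApproxError s x := by
  refine Real.sInf_nonneg ?_
  rintro _ ⟨z, _, rfl⟩
  exact ellNorm_nonneg le_rfl _

lemma recovery_of_lower_bound_on_cone {m N s : ℕ} (hs : 1 ≤ s) (hm : 0 < m)
    {Φ : Matrix (Fin m) (Fin N) ℝ}
    (hΦ : ∀ h : Fin N → ℝ, ellNorm 1 h ≤ 3 * √s * ellNorm 2 h →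
      m / 200 * ellNorm 2 h ≤ ellNorm 1 (Φ *ᵥ h))
    {p : ℝ≥0∞} (hp : 1 ≤ p) {x : Fin N → ℝ} {e : Fin m → ℝ} {ε : ℝ} (he : ellNorm p e ≤ ε)
    {xStar : Fin N → ℝ} (hx : IsL1Minimizer p Φ (Φ *ᵥ x + e) ε xStar) :
    ellNorm 2 (xStar - x) ≤
      2 / √s * bestApproxError s x + 400 / (m : ℝ) ^ (p⁻¹).toReal * ε := by
  obtain ⟨hfeas, hmin⟩ := hx
  have hm0 : (0 : ℝ) < m := by exact_mod_cast hm
  have hsq : 0 < √(s : ℝ) := Real.sqrt_pos.2 (by exact_mod_cast hs)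
  have hε : 0 ≤ ε := (ellNorm_nonneg hp e).trans he
  have hpow : 0 < (m : ℝ) ^ (p⁻¹).toReal := Real.rpow_pos_of_pos hm0 _
  have hσ := bestApproxError_nonneg s x
  set h := xStar - x with hh
  have hxf : x ∈ feasibleSet p Φ (Φ *ᵥ x + e) ε := by
    simpa [feasibleSet, ellNorm_neg hp] using he
  have hcone : ellNorm 1 h ≤ 2 * √s * ellNorm 2 h + 2 * bestApproxError s x := by
    refine ellNorm_one_le_of_ellNorm_one_add_le ?_
    rw [hh, add_sub_cancel]
    exact hmin x hxf
  have hres : ellNorm p (Φ *ᵥ h) ≤ 2 * ε := by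
    have h1 := ellNorm_add_le hp (Φ *ᵥ xStar - (Φ *ᵥ x + e)) e
    have h2 : Φ *ᵥ xStar - (Φ *ᵥ x + e) + e = Φ *ᵥ h := by
      rw [hh, Matrix.mulVec_sub]; abel
    rw [h2] at h1
    have h3 : ellNorm p (Φ *ᵥ xStar - (Φ *ᵥ x + e)) ≤ ε := hfeas
    linarith
  rcases le_total (√s * ellNorm 2 h) (2 * bestApproxError s x) with hc | hc
  · have h1 : ellNorm 2 h ≤ 2 / √s * bestApproxError s x := by
      rw [div_mul_eq_mul_div, le_div_iff₀ hsq]; linarith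
    have : 0 ≤ 400 / (m : ℝ) ^ (p⁻¹).toReal * ε := by positivity
    linarith
  · have h1 := hΦ h (by linarith)
    have h2 := ellNorm_one_le_ellNorm_mul hm hp (Φ *ᵥ h)
    have h3 : m / 200 * ellNorm 2 h ≤ m / (m : ℝ) ^ (p⁻¹).toReal * (2 * ε) :=
      h1.trans (h2.trans (by gcongr))
    have h4 : ellNorm 2 h ≤ 400 / (m : ℝ) ^ (p⁻¹).toReal * ε := by
      refine le_of_mul_le_mul_left (h3.trans (le_of_eq ?_)) (by positivity : (0 : ℝ) < m / 200)
      field_simp; ring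
    have : 0 ≤ 2 / √s * bestApproxError s x := by positivity
    linarith

/-! ### The exceptional event -/

namespace IsStandardGaussianMatrix

variable {Ω : Type*} [MeasurableSpace Ω] {P : Measure Ω} {m N : ℕ}
  {Φ : Ω → Matrix (Fin m) (Fin N) ℝ}

/-- The event on which the upper bound for all vectors may fail: each of the `2 ^ m ≤ e ^ m` sign
vectors contributes at most `exp (-3 m)`. -/
lemma measure_exists_sign_excess_le (hΦ : IsStandardGaussianMatrix P Φ) (hm : 0 < m) {t : ℝ}
    (ht : 0 ≤ t) (htN : √2 * Real.exp (-(t ^ 2 / 4)) * N ≤ m) :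
    P {ω | ∃ σ : Fin m → ℝ, (∀ i, σ i = 1 ∨ σ i = -1) ∧
        16 * m ≤ ∑ j, max (|(σ ᵥ* Φ ω) j| / √m - t) 0 ^ 2}
      ≤ ENNReal.ofReal (Real.exp (-(2 * m))) := by
  classical
  set S : Finset (Fin m → ℝ) := Fintype.piFinset fun _ => {1, -1} with hS
  have hmem : ∀ σ, σ ∈ S ↔ ∀ i, σ i = 1 ∨ σ i = -1 := by simp [hS]
  have hcard : (S.card : ℝ) ≤ Real.exp m := by
    have h1 : S.card = 2 ^ m := by
      rw [hS, Fintype.card_piFinset_const, Finset.card_pair (by norm_num)]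
    rw [h1]
    push_cast
    have := Real.add_one_le_exp (1 : ℝ)
    calc (2 : ℝ) ^ m ≤ Real.exp 1 ^ m := by gcongr; linarith
      _ = _ := by rw [← Real.exp_nat_mul, mul_one]
  calc _ ≤ P (⋃ σ ∈ S, {ω | 16 * m ≤ ∑ j, max (|(σ ᵥ* Φ ω) j| / √m - t) 0 ^ 2}) := by
        refine measure_mono ?_
        rintro ω ⟨σ, hσ, h⟩
        exact Set.mem_biUnion ((hmem σ).2 hσ) h
    _ ≤ ∑ σ ∈ S, P {ω | 16 * m ≤ ∑ j, max (|(σ ᵥ* Φ ω) j| / √m - t) 0 ^ 2} :=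
        measure_biUnion_finset_le _ _
    _ ≤ ∑ _σ ∈ S, ENNReal.ofReal (Real.exp (-(3 * m))) := by
        refine Finset.sum_le_sum fun σ hσ => ?_
        refine (hΦ.measure_sum_sq_excess_vecMul_ge hm (fun i => ?_) ht _).trans
          (ENNReal.ofReal_le_ofReal (Real.exp_le_exp.2 ?_))
        · rcases (hmem σ).1 hσ i with h | h <;> simp [h]
        · linarith
    _ = ENNReal.ofReal (S.card * Real.exp (-(3 * m))) := by
        rw [Finset.sum_const, nsmul_eq_mul, ENNReal.ofReal_mul (by positivity),
          ENNReal.ofReal_natCast]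
    _ ≤ ENNReal.ofReal (Real.exp m * Real.exp (-(3 * m))) := by gcongr
    _ = _ := by rw [← Real.exp_add]; ring_nf

lemma measure_exists_lattice_le (hΦ : IsStandardGaussianMatrix P Φ) {M : ℕ}
    (hM : ((latticeBall N M).card : ℝ) ≤ Real.exp m) :
    P {ω | ∃ n ∈ latticeBall N M, n ≠ 0 ∧
        ellNorm 1 (Φ ω *ᵥ fun j => (n j : ℝ)) ≤ m / 100 * ellNorm 2 (fun j => (n j : ℝ))}
      ≤ ENNReal.ofReal (Real.exp (-(2 * m))) := by
  calc _ ≤ P (⋃ n ∈ (latticeBall N M).erase 0, {ω | ellNorm 1 (Φ ω *ᵥ fun j => (n j : ℝ))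
          ≤ m / 100 * ellNorm 2 (fun j => (n j : ℝ))}) := by
        refine measure_mono ?_
        rintro ω ⟨n, hn, hn0, h⟩
        exact Set.mem_biUnion (Finset.mem_erase.2 ⟨hn0, hn⟩) h
    _ ≤ ∑ n ∈ (latticeBall N M).erase 0, P {ω | ellNorm 1 (Φ ω *ᵥ fun j => (n j : ℝ))
          ≤ m / 100 * ellNorm 2 (fun j => (n j : ℝ))} := measure_biUnion_finset_le _ _
    _ ≤ ∑ _n ∈ (latticeBall N M).erase 0, ENNReal.ofReal (Real.exp (-(3 * m))) := by
        refine Finset.sum_le_sum fun n hn => hΦ.measure_ellNorm_one_mulVec_le fun h => ?_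
        refine (Finset.mem_erase.1 hn).1 ?_
        ext j
        simpa using congrFun h j
    _ ≤ ∑ _n ∈ latticeBall N M, ENNReal.ofReal (Real.exp (-(3 * m))) :=
        Finset.sum_le_sum_of_subset (Finset.erase_subset _ _)
    _ = ENNReal.ofReal ((latticeBall N M).card * Real.exp (-(3 * m))) := by
        rw [Finset.sum_const, nsmul_eq_mul, ENNReal.ofReal_mul (by positivity),
          ENNReal.ofReal_natCast]
    _ ≤ ENNReal.ofReal (Real.exp m * Real.exp (-(3 * m))) := by gcongr
    _ = _ := by rw [← Real.exp_add]; ring_nf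

lemma exists_measurableSet_lower_bound_on_cone (hΦ : IsStandardGaussianMatrix P Φ)
    [IsProbabilityMeasure P] {η : ℝ} (hη : 0 < η) (hη1 : η < 1) {s : ℕ} (hs : 1 ≤ s)
    (hsN : s ≤ N) (hm : 100000000 * s * Real.log (Real.exp 1 * N / s) + Real.log (2 * η⁻¹) ≤ m) :
    ∃ E : Set Ω, MeasurableSet E ∧ ENNReal.ofReal (1 - η) < P E ∧
      ∀ ω ∈ E, ∀ h : Fin N → ℝ, ellNorm 1 h ≤ 3 * √s * ellNorm 2 h →
        m / 200 * ellNorm 2 h ≤ ellNorm 1 (Φ ω *ᵥ h) := by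
  have hs0 : (0 : ℝ) < s := by exact_mod_cast hs
  have hN0 : (0 : ℝ) < N := by exact_mod_cast hs.trans hsN
  set L := Real.log (Real.exp 1 * N / s) with hLdef
  have hq0 : 0 < Real.exp 1 * N / s := by positivity
  have hL1 : 1 ≤ L := one_le_log_exp_one_mul_div hs hsN
  have hlog : 0 < Real.log (2 * η⁻¹) :=
    Real.log_pos (by have := (one_lt_inv₀ hη).2 hη1; linarith)
  have hsL : (s : ℝ) ≤ s * L := le_mul_of_one_le_right hs0.le hL1
  have hm0' : (0 : ℝ) < m := by linarith
  have hm0 : 0 < m := by exact_mod_cast hm0'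
  have hsm : (s : ℝ) ≤ m := by linarith
  -- With `t = 4 √m / (9600 √s)` the bound for all vectors takes the form used on the cone.
  set t : ℝ := √m / (2400 * √s) with ht
  have ht0 : 0 ≤ t := by positivity
  have ht2 : L ≤ t ^ 2 / 4 := by
    rw [ht, div_pow, mul_pow, Real.sq_sqrt hm0'.le, Real.sq_sqrt hs0.le, div_div,
      le_div_iff₀ (by positivity)]
    linarith
  have htN : √2 * Real.exp (-(t ^ 2 / 4)) * N ≤ m := by
    have h2 : √(2 : ℝ) ≤ Real.exp 1 := by
      have := Real.add_one_le_exp (1 : ℝ)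
      refine Real.sqrt_le_iff.2 ⟨by positivity, ?_⟩
      nlinarith
    calc √2 * Real.exp (-(t ^ 2 / 4)) * N ≤ Real.exp 1 * Real.exp (-L) * N := by gcongr
      _ = s := by rw [hLdef, Real.exp_neg, Real.exp_log hq0]; field_simp
      _ ≤ m := hsm
  have hM : ((latticeBall N (92160000 * s)).card : ℝ) ≤ Real.exp m := by
    refine (card_latticeBall_le_exp hs hsN _).trans (Real.exp_le_exp.2 ?_)
    push_cast
    rw [← hLdef]
    linarith
  set B1 := {ω | ∃ σ : Fin m → ℝ, (∀ i, σ i = 1 ∨ σ i = -1) ∧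
        16 * m ≤ ∑ j, max (|(σ ᵥ* Φ ω) j| / √m - t) 0 ^ 2} with hB1
  set B2 := {ω | ∃ n ∈ latticeBall N (92160000 * s), n ≠ 0 ∧
        ellNorm 1 (Φ ω *ᵥ fun j => (n j : ℝ)) ≤ m / 100 * ellNorm 2 (fun j => (n j : ℝ))} with hB2
  have hB : P (B1 ∪ B2) < ENNReal.ofReal η := by
    calc P (B1 ∪ B2) ≤ P B1 + P B2 := measure_union_le _ _
      _ ≤ ENNReal.ofReal (Real.exp (-(2 * m))) + ENNReal.ofReal (Real.exp (-(2 * m))) :=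
          add_le_add (hΦ.measure_exists_sign_excess_le hm0 ht0 htN)
            (hΦ.measure_exists_lattice_le hM)
      _ = ENNReal.ofReal (2 * Real.exp (-(2 * m))) := by
          rw [← ENNReal.ofReal_add (by positivity) (by positivity), two_mul (Real.exp _)]
      _ < ENNReal.ofReal η := by
          refine (ENNReal.ofReal_lt_ofReal_iff hη).2 ?_
          have h1 : Real.log (2 * η⁻¹) < 2 * m := by linarith
          have h2 : 2 * η⁻¹ < Real.exp (2 * m) := (Real.log_lt_iff_lt_exp (by positivity)).1 h1
          rw [Real.exp_neg, ← div_eq_mul_inv, div_lt_iff₀ (by positivity)]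
          rwa [← div_eq_mul_inv, div_lt_iff₀ hη, mul_comm] at h2
  -- The entries of `Φ` are only a.e. measurable, so the event is cut out by a measurable hull.
  refine ⟨(toMeasurable P (B1 ∪ B2))ᶜ, (measurableSet_toMeasurable _ _).compl, ?_, ?_⟩
  · rw [prob_compl_eq_one_sub (measurableSet_toMeasurable _ _), measure_toMeasurable,
      lt_tsub_iff_right]
    calc _ < ENNReal.ofReal (1 - η) + ENNReal.ofReal η :=
          ENNReal.add_lt_add_left ENNReal.ofReal_ne_top hB
      _ = 1 := by
          rw [← ENNReal.ofReal_add (by linarith) hη.le, sub_add_cancel, ENNReal.ofReal_one]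
  · intro ω hω h hh
    have hω' : ω ∉ B1 ∪ B2 := fun h => hω (subset_toMeasurable _ _ h)
    rw [Set.mem_union, not_or] at hω'
    refine lower_bound_on_cone hs (fun v => ?_) (fun n hn hn0 => ?_) hh
    · refine (ellNorm_one_mulVec_le_of_sq_excess_le hm0 (t := t) (c := 4) (by norm_num)
        (fun σ hσ => ?_) v).trans (le_of_eq ?_)
      · by_contra! hlt
        exact hω'.1 ⟨σ, hσ, by linarith⟩
      · have hmm : √(m : ℝ) * √m = m := Real.mul_self_sqrt hm0'.le
        calc √m * (4 * √m * ellNorm 2 v + t * ellNorm 1 v)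
            = 4 * (√m * √m) * (ellNorm 2 v + ellNorm 1 v / (9600 * √s)) := by
              rw [ht]; field_simp; ring
          _ = _ := by rw [hmm]
    · by_contra! hlt
      exact hω'.2 ⟨n, hn, hn0, hlt.le⟩

end IsStandardGaussianMatrix

theorem corollary1 :
    ∃ C D C' D' : ℝ, 0 < C ∧ 0 < D ∧ 0 < C' ∧ 0 < D' ∧
      ∀ (p : ℝ≥0∞), 1 ≤ p →
      ∀ (η : ℝ), 0 < η → η < 1 →
      ∀ (m N s : ℕ), 1 ≤ s → s ≤ N →
        C * s * Real.log (Real.exp 1 * N / s) + D * Real.log (2 * η⁻¹) ≤ (m : ℝ) →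
      ∀ {Ω : Type*} [MeasurableSpace Ω] (P : Measure Ω) [IsProbabilityMeasure P]
        (Φ : Ω → Matrix (Fin m) (Fin N) ℝ), IsStandardGaussianMatrix P Φ →
        ∃ E : Set Ω, MeasurableSet E ∧ ENNReal.ofReal (1 - η) < P E ∧
          ∀ ω ∈ E, ∀ (x : Fin N → ℝ) (e : Fin m → ℝ) (ε : ℝ), ellNorm p e ≤ ε →
            ∀ xStar : Fin N → ℝ, IsL1Minimizer p (Φ ω) (Φ ω *ᵥ x + e) ε xStar →
              ellNorm 2 (xStar - x) ≤
                C' / Real.sqrt s * bestApproxError s x + D' / (m : ℝ) ^ (p⁻¹).toReal * ε := by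
  -- `C` dominates the exponent `92160000 s log (e N / s) + 2 s` of the lattice point count.
  refine ⟨100000000, 1, 2, 400, by norm_num, by norm_num, by norm_num, by norm_num, ?_⟩
  intro p hp η hη hη1 m N s hs hsN hm Ω _ P _ Φ hΦ
  rw [one_mul] at hm
  have hlog : 0 < Real.log (2 * η⁻¹) :=
    Real.log_pos (by have := (one_lt_inv₀ hη).2 hη1; linarith)
  have hm0 : 0 < m := by
    have hL := one_le_log_exp_one_mul_div hs hsN
    have : 0 ≤ 100000000 * s * Real.log (Real.exp 1 * N / s) := by positivity
    exact_mod_cast (by linarith : (0 : ℝ) < m)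
  obtain ⟨E, hE, hPE, h⟩ :=
    hΦ.exists_measurableSet_lower_bound_on_cone hη hη1 hs hsN hm
  exact ⟨E, hE, hPE, fun ω hω x e ε he xStar hx =>
    recovery_of_lower_bound_on_cone hs hm0 (h ω hω) hp he hx⟩
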